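/- Let $X$ be a complex Banach space and $T$ a bounded linear operator on $X$. For a bounded operator $S$ on a Banach space $Y$, write $\mathcal N(S)$ and $\mathcal R(S)$ for its kernel and range, $\alpha(S)=\dim\mathcal N(S)$ and $\beta(S)=\operatorname{codim}\mathcal R(S)=\dim Y/\mathcal R(S)$ (both in $\mathbb N\cup\{\infty\}$), and $$p(S)=\inf\{n\in\mathbb N:\mathcal N(S^n)=\mathcal N(S^{n+1})\},\qquad q(S)=\inf\{n\in\mathbb N:\mathcal R(S^n)=\mathcal R(S^{n+1})\},\qquad \inf\emptyset=\infty,$$ for its ascent and descent. $S$ is called semi-regular if $\mathcal R(S)$ is closed and $\mathcal N(S)\cap\mathcal R(S^m)=\mathcal N(S)$ for all $m\in\mathbb N$ (that is, the degree of stable iteration $\operatorname{dis}(S)=\inf\{m\in\mathbb N:\mathcal N(S)\cap\mathcal R(S^m)=\mathcal N(S)\cap\mathcal R(S^r)\ \forall r\ge m\}$ is $0$), and zeroloid if every accumulation point of its spectrum $\sigma(S)$ is $0$. A generalized Kato zeroloid decomposition of $T$, written $(M,N)\in g_zKD(T)$, is a pair of closed $T$-invariant subspaces $M,N$ of $X$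 with $X=M\oplus N$ such that the restriction $T_M$ of $T$ to $M$ is semi-regular and the restriction $T_N$ of $T$ to $N$ is zeroloid; $T$ is called $g_z$-Kato if such a pair exists. If $T$ is $g_z$-Kato, then $\alpha(T_M)$, $\beta(T_M)$, $p(T_M)$ and $q(T_M)$ do not depend on the choice of $(M,N)\in g_zKD(T)$: for all $(M_1,N_1),(M_2,N_2)\in g_zKD(T)$, $$\alpha(T_{M_1})=\alpha(T_{M_2}),\quad \beta(T_{M_1})=\beta(T_{M_2}),\quad p(T_{M_1})=p(T_{M_2}),\quad q(T_{M_1})=q(T_{M_2}).$$ Consequently $\tilde\alpha(T)=\alpha(T_M)$, $\tilde\beta(T)=\beta(T_M)$, $\tilde p(T)=p(T_M)$ and $\tilde q(T)=q(T_M)$, where $(M,N)\in g_zKD(T)$ is arbitrary, are well defined. -/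

import Mathlib

namespace GzKato

noncomputable section

variable {X : Type*} [NormedAddCommGroup X] [NormedSpace ℂ X]

/-- `α(T)`: the dimension of the kernel of `T`, in `ℕ ∪ {∞}`. -/
def alpha (T : X →L[ℂ] X) : ℕ∞ :=
  Cardinal.toENat (Module.rank ℂ (LinearMap.ker (T : X →ₗ[ℂ] X)))

/-- `β(T)`: the (algebraic) codimension of the range of `T`, in `ℕ ∪ {∞}`. -/
def beta (T : X →L[ℂ] X) : ℕ∞ :=
  Cardinal.toENat (Module.rank ℂ (X ⧸ LinearMap.range (T : X →ₗ[ℂ] X)))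

/-- The kernel of `T ^ n`. -/
def kerPow (T : X →L[ℂ] X) (n : ℕ) : Submodule ℂ X :=
  LinearMap.ker ((T ^ n : X →L[ℂ] X) : X →ₗ[ℂ] X)

/-- The range of `T ^ n`. -/
def rangePow (T : X →L[ℂ] X) (n : ℕ) : Submodule ℂ X :=
  LinearMap.range ((T ^ n : X →L[ℂ] X) : X →ₗ[ℂ] X)

/-- The infimum of a set of natural numbers in `ℕ ∪ {∞}`; the infimum of `∅` is `∞`. -/
def natInf (S : Set ℕ) : ℕ∞ := ⨅ n ∈ S, (n : ℕ∞)

/-- The ascent `p(T)`. -/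
def ascent (T : X →L[ℂ] X) : ℕ∞ :=
  natInf {n : ℕ | kerPow T n = kerPow T (n + 1)}

/-- The descent `q(T)`. -/
def descent (T : X →L[ℂ] X) : ℕ∞ :=
  natInf {n : ℕ | rangePow T n = rangePow T (n + 1)}

/-- The degree of stable iteration `dis(T)`: the least `m` such that
`N(T) ∩ R(T ^ m) = N(T) ∩ R(T ^ r)` for all `r ≥ m`. Here `N(T) ∩ R(T ^ m)` is the kernel of the
restriction of `T` to `R(T ^ m)`. -/
def dis (T : X →L[ℂ] X) : ℕ∞ :=
  natInf {m : ℕ | ∀ r : ℕ, m ≤ r → kerPow T 1 ⊓ rangePow T m = kerPow T 1 ⊓ rangePow T r}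

/-- `T` is semi-regular: its range is closed and `dis(T) = 0`. -/
def IsSemiRegular (T : X →L[ℂ] X) : Prop :=
  IsClosed (Set.range T) ∧ dis T = 0

/-- `T` is zeroloid: every accumulation point of its spectrum is `0`. -/
def IsZeroloid (T : X →L[ℂ] X) : Prop :=
  {z : ℂ | AccPt z (Filter.principal (spectrum ℂ T))} ⊆ {0}

/-- The restriction `T_M` of `T` to a `T`-invariant subspace `M`, as a bounded operator on `M`. -/
def restr (T : X →L[ℂ] X) (M : Submodule ℂ X) (h : ∀ x ∈ M, T x ∈ M) : M →L[ℂ] M :=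
  T.restrict h

/-- `(M, N) ∈ Red(T)`: `M` and `N` are closed `T`-invariant subspaces and `X = M ⊕ N`. -/
structure IsRed (T : X →L[ℂ] X) (M N : Submodule ℂ X) : Prop where
  closed_left : IsClosed (M : Set X)
  closed_right : IsClosed (N : Set X)
  inv_left : ∀ x ∈ M, T x ∈ M
  inv_right : ∀ x ∈ N, T x ∈ N
  isCompl : IsCompl M N

/-- `(M, N) ∈ g_z KD(T)`: `(M, N) ∈ Red(T)`, `T_M` is semi-regular and `T_N` is zeroloid. -/
structure IsGzKD (T : X →L[ℂ] X) (M N : Submodule ℂ X) : Prop extends IsRed T M N where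
  semiRegular : IsSemiRegular (restr T M inv_left)
  zeroloid : IsZeroloid (restr T N inv_right)

/-- `T` is a `g_z`-Kato operator. -/
def IsGzKato (T : X →L[ℂ] X) : Prop :=
  ∃ M N : Submodule ℂ X, IsGzKD T M N

/-- The restriction of a `g_z`-Kato operator `T` to the first summand of some (chosen)
decomposition in `g_z KD(T)`. -/
def chosenPart (T : X →L[ℂ] X) (hT : IsGzKato T) : hT.choose →L[ℂ] hT.choose :=
  restr T hT.choose hT.choose_spec.choose_spec.inv_left

/-- `α̃(T)`, computed from a chosen decomposition. -/
def alphaTilde (T : X →L[ℂ] X) (hT : IsGzKato T) : ℕ∞ := alpha (chosenPart T hT)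

/-- `β̃(T)`, computed from a chosen decomposition. -/
def betaTilde (T : X →L[ℂ] X) (hT : IsGzKato T) : ℕ∞ := beta (chosenPart T hT)

/-- `p̃(T)`, computed from a chosen decomposition. -/
def ascentTilde (T : X →L[ℂ] X) (hT : IsGzKato T) : ℕ∞ := ascent (chosenPart T hT)

/-- `q̃(T)`, computed from a chosen decomposition. -/
def descentTilde (T : X →L[ℂ] X) (hT : IsGzKato T) : ℕ∞ := descent (chosenPart T hT)

end

end GzKato

/-!
Let `A` be semi-regular with hyperrange `R = ⋂ n, R(A ^ n)`. Then `R` is closed, `A(R) = R` and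
`A⁻¹(R) = R`. For small `z ≠ 0` the kernel of `A - z` lies in `R` and its range contains `R`, so
`α(A - z)` is the nullity of a perturbation of the surjection `A|_R`, and `β(A - z)` is the defect
of a perturbation of the operator induced on the quotient by `R`, which is injective with closed
range. Nullity is continuous at surjections and defect at injections with closed range, whence
`α(A - z) → α(A)` and `β(A - z) → β(A)` as `z → 0`.

If `X = M ⊕ N` with `T_M` semi-regular and `T_N` zeroloid, there are `z ≠ 0` arbitrarily close to
`0` outside `σ(T_N)`, and for these `α(T_M - z) = α(T - z)` and `β(T_M - z) = β(T - z)` do not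
depend on the decomposition. For two decompositions such `z` can be chosen in common, and `z → 0`
gives `α` and `β`. Ascent and descent follow: for a semi-regular operator they are `0` or `∞`
according to whether `α`, respectively `β`, vanishes.
-/

namespace GzKato

open Filter (Tendsto)
open Function LinearMap Module Topology
open scoped Filter

section LinearAlgebra

variable {R M : Type*} [Ring R] [AddCommGroup M] [Module R M]

theorem rank_ker_restrict {f : End R M} {P : Submodule R M} (hP : ∀ x ∈ P, f x ∈ P)
    (hf : ker f ≤ P) : Module.rank R (ker (f.restrict hP)) = Module.rank R (ker f) := by
  rw [ker_restrict]
  exact (Submodule.comapSubtypeEquivOfLe hf).rank_eq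

theorem rank_quotient_range_mapQ {f : End R M} {P : Submodule R M} (hP : P ≤ P.comap f)
    (hf : P ≤ range f) :
    Module.rank R ((M ⧸ P) ⧸ range (P.mapQ P f hP)) = Module.rank R (M ⧸ range f) := by
  rw [Submodule.range_mapQ]
  exact (Submodule.quotientQuotientEquivQuotient P _ hf).rank_eq

section Reducing

variable {f : End R M} {P Q : Submodule R M}

theorem ker_le_of_isCompl_of_injective_restrict (hP : ∀ x ∈ P, f x ∈ P)
    (hQ : ∀ x ∈ Q, f x ∈ Q) (hPQ : IsCompl P Q) (hf : Injective (f.restrict hQ)) :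
    ker f ≤ P := by
  intro x hx
  obtain ⟨p, q, hp, hq, rfl⟩ := Submodule.codisjoint_iff_exists_add_eq.1 hPQ.codisjoint x
  have hfq : f q = -f p := eq_neg_of_add_eq_zero_right ((map_add f p q).symm.trans hx)
  have hfq₀ : f q = 0 :=
    Submodule.disjoint_def.1 hPQ.disjoint _ (hfq ▸ P.neg_mem (hP p hp)) (hQ q hq)
  have hq₀ : (⟨q, hq⟩ : Q) = 0 := hf (Subtype.ext (by simpa using hfq₀))
  have : q = 0 := congrArg Subtype.val hq₀
  simpa [this] using hp

theorem rank_quotient_range_restrict_of_isCompl (hP : ∀ x ∈ P, f x ∈ P)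
    (hQ : ∀ x ∈ Q, f x ∈ Q) (hPQ : IsCompl P Q) (hf : Surjective (f.restrict hQ)) :
    Module.rank R (P ⧸ range (f.restrict hP)) = Module.rank R (M ⧸ range f) := by
  have hQf : Q ≤ range f := fun x hx =>
    let ⟨y, hy⟩ := hf ⟨x, hx⟩
    ⟨y, congrArg Subtype.val hy⟩
  let e : P ≃ₗ[R] M ⧸ Q := (Submodule.quotientEquivOfIsCompl Q P hPQ.symm).symm
  have hconj : e.toLinearMap ∘ₗ f.restrict hP = Q.mapQ Q f hQ ∘ₗ e.toLinearMap := by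
    ext x
    simp [e]
  have hrange : (range (f.restrict hP)).map e.toLinearMap = range (Q.mapQ Q f hQ) := by
    rw [← range_comp, hconj, range_comp_of_range_eq_top _ e.range]
  rw [← rank_quotient_range_mapQ hQ hQf]
  exact (Submodule.Quotient.equiv _ _ e hrange).rank_eq

end Reducing

section Prod

universe u

variable {V : Type*} {E G : Type u} [AddCommGroup V] [Module R V] [AddCommGroup E] [Module R E]
  [AddCommGroup G] [Module R G]

theorem rank_le_rank_ker_of_surjective_prod {f : E →ₗ[R] V} {π : E →ₗ[R] G}
    (h : Surjective (f.prod π)) : Module.rank R G ≤ Module.rank R (ker f) := by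
  refine rank_le_of_surjective (π.domRestrict (ker f)) fun y => ?_
  obtain ⟨x, hx⟩ := h (0, y)
  exact ⟨⟨x, congrArg Prod.fst hx⟩, congrArg Prod.snd hx⟩

theorem rank_ker_le_of_injective_prod {f : E →ₗ[R] V} {π : E →ₗ[R] G}
    (h : Injective (f.prod π)) : Module.rank R (ker f) ≤ Module.rank R G :=
  rank_le_of_injective (π.domRestrict (ker f)) fun x y hxy =>
    Subtype.ext (h (Prod.ext (x.2.trans y.2.symm) hxy))

theorem rank_le_rank_quotient_range_of_injective_coprod {f : V →ₗ[R] E} {ι : G →ₗ[R] E}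
    (h : Injective (f.coprod ι)) : Module.rank R G ≤ Module.rank R (E ⧸ range f) := by
  refine rank_le_of_injective ((range f).mkQ ∘ₗ ι) (ker_eq_bot.1 (ker_eq_bot'.2 fun y hy => ?_))
  obtain ⟨x, hx⟩ := (Submodule.Quotient.mk_eq_zero _).1 hy
  have : ((-x, y) : V × G) = 0 := h (by simp [hx])
  exact congrArg Prod.snd this

theorem rank_quotient_range_le_of_surjective_coprod {f : V →ₗ[R] E} {ι : G →ₗ[R] E}
    (h : Surjective (f.coprod ι)) : Module.rank R (E ⧸ range f) ≤ Module.rank R G := by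
  refine rank_le_of_surjective ((range f).mkQ ∘ₗ ι) fun z => ?_
  obtain ⟨w, rfl⟩ := (range f).mkQ_surjective z
  obtain ⟨⟨x, y⟩, rfl⟩ := h w
  exact ⟨y, by simp⟩

end Prod

/-- The hyperrange `⋂ n, R(f ^ n)` of an endomorphism. -/
def hyperrange (f : End R M) : Submodule R M := ⨅ n, range (f ^ n)

section Hyperrange

variable {f : End R M}

theorem mem_hyperrange {x : M} : x ∈ hyperrange f ↔ ∀ n, ∃ y, (f ^ n) y = x := by
  simp [hyperrange]

theorem hyperrange_le_range_pow (n : ℕ) : hyperrange f ≤ range (f ^ n) :=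
  iInf_le _ n

theorem hyperrange_le_range : hyperrange f ≤ range f :=
  (hyperrange_le_range_pow 1).trans_eq (by rw [pow_one])

theorem map_mem_hyperrange : ∀ x ∈ hyperrange f, f x ∈ hyperrange f := by
  intro x hx
  rw [mem_hyperrange] at hx ⊢
  intro n
  obtain ⟨y, rfl⟩ := hx n
  exact ⟨f y, by rw [← End.mul_apply, ← End.mul_apply, ← pow_succ, pow_succ']⟩

theorem eigenspace_le_hyperrange {K V : Type*} [Field K] [AddCommGroup V] [Module K V]
    {f : End K V} {μ : K} (hμ : μ ≠ 0) : f.eigenspace μ ≤ hyperrange f := by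
  intro x hx
  have hpow : ∀ n : ℕ, (f ^ n) x = μ ^ n • x := by
    intro n
    induction n with
    | zero => simp
    | succ n ih => rw [pow_succ', End.mul_apply, ih, map_smul, End.mem_eigenspace_iff.1 hx,
        smul_smul, pow_succ]
  exact mem_hyperrange.2 fun n =>
    ⟨(μ ^ n)⁻¹ • x, by rw [map_smul, hpow, inv_smul_smul₀ (pow_ne_zero n hμ)]⟩

theorem comap_hyperrange (hf : ker f ≤ hyperrange f) :
    (hyperrange f).comap f = hyperrange f := by
  refine le_antisymm (fun x hx => mem_hyperrange.2 fun n => ?_) map_mem_hyperrange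
  obtain ⟨w, hw⟩ := mem_hyperrange.1 hx (n + 1)
  have hxw : x - (f ^ n) w ∈ ker f := by
    rw [LinearMap.mem_ker, map_sub, ← hw, pow_succ', End.mul_apply, sub_self]
  obtain ⟨v, hv⟩ := mem_hyperrange.1 (hf hxw) n
  exact ⟨v + w, by rw [map_add, hv, sub_add_cancel]⟩

theorem map_hyperrange (hf : ker f ≤ hyperrange f) :
    (hyperrange f).map f = hyperrange f := by
  conv_lhs => rw [← comap_hyperrange hf]
  exact Submodule.map_comap_eq_self hyperrange_le_range

theorem ker_pow_le_range (hf : ker f ≤ hyperrange f) (n : ℕ) : ker (f ^ n) ≤ range f := by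
  induction n with
  | zero => simp [End.one_eq_id]
  | succ n ih =>
    intro x hx
    rw [LinearMap.mem_ker, pow_succ', End.mul_apply] at hx
    obtain ⟨y, hy⟩ := mem_hyperrange.1 (hf hx) (n + 1)
    obtain ⟨w, hw⟩ := ih (show x - f y ∈ ker (f ^ n) by
      rw [LinearMap.mem_ker, map_sub, ← hy, pow_succ, End.mul_apply, sub_self])
    exact ⟨w + y, by rw [map_add, hw, sub_add_cancel]⟩

theorem ker_eq_bot_of_ker_pow_eq (hf : ker f ≤ hyperrange f) {n : ℕ}
    (h : ker (f ^ n) = ker (f ^ (n + 1))) : ker f = ⊥ := by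
  refine ker_eq_bot'.2 fun x hx => ?_
  obtain ⟨y, rfl⟩ := mem_hyperrange.1 (hf hx) n
  have : y ∈ ker (f ^ (n + 1)) := by rwa [LinearMap.mem_ker, pow_succ', End.mul_apply]
  rwa [← h] at this

theorem range_eq_top_of_range_pow_eq (hf : ker f ≤ hyperrange f) {n : ℕ}
    (h : range (f ^ n) = range (f ^ (n + 1))) : range f = ⊤ := by
  refine eq_top_iff.2 fun x _ => ?_
  obtain ⟨y, hy⟩ : (f ^ n) x ∈ range (f ^ (n + 1)) := h ▸ mem_range_self _ x
  obtain ⟨w, hw⟩ := ker_pow_le_range hf n (show x - f y ∈ ker (f ^ n) by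
    rw [LinearMap.mem_ker, map_sub, ← hy, pow_succ, End.mul_apply, sub_self])
  exact ⟨w + y, by rw [map_add, hw, sub_add_cancel]⟩

end Hyperrange

theorem exists_finiteDimensional_le_of_le_rank {K V : Type*} [DivisionRing K] [AddCommGroup V]
    [Module K V] {W : Submodule K V} {n : ℕ} (h : n ≤ Module.rank K W) :
    ∃ U ≤ W, FiniteDimensional K U ∧ Module.rank K U = n := by
  obtain ⟨v, hv⟩ := le_rank_iff.1 h
  have hw : LinearIndependent K (W.subtype ∘ v) := hv.map' _ W.ker_subtype
  refine ⟨Submodule.span K (Set.range (W.subtype ∘ v)), ?_,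
    FiniteDimensional.span_of_finite K (Set.finite_range _), ?_⟩
  · rw [Submodule.span_le]
    rintro _ ⟨i, rfl⟩
    exact (v i).2
  · simpa using rank_eq_card_basis (Basis.span hw)

theorem tendsto_toENat_rank {K V : Type*} [DivisionRing K] [AddCommGroup V] [Module K V]
    {W : Submodule K V} {α : Type*} {l : Filter α} {r : α → Cardinal}
    (hlow : ∀ U ≤ W, FiniteDimensional K U → ∀ᶠ a in l, Module.rank K U ≤ r a)
    (hup : FiniteDimensional K W → ∀ᶠ a in l, r a ≤ Module.rank K W) :
    Tendsto (fun a => (r a).toENat) l (𝓝 (Module.rank K W).toENat) := by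
  by_cases hW : FiniteDimensional K W
  · refine tendsto_const_nhds.congr' ?_
    filter_upwards [hlow W le_rfl hW, hup hW] with a h₁ h₂
    rw [le_antisymm h₁ h₂]
  · have hrank : Cardinal.aleph0 ≤ Module.rank K W := not_lt.1 (mt rank_lt_aleph0_iff.1 hW)
    rw [Cardinal.toENat_eq_top.2 hrank, ENat.tendsto_nhds_top_iff_natCast_lt]
    intro n
    obtain ⟨U, hUW, hU, hUn⟩ := exists_finiteDimensional_le_of_le_rank
      (show ((n + 1 : ℕ) : Cardinal) ≤ Module.rank K W from Cardinal.natCast_le_aleph0.trans hrank)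
    filter_upwards [hlow U hUW hU] with a ha
    rw [Cardinal.natCast_lt_toENat]
    exact (Nat.cast_lt.2 n.lt_succ_self).trans_le (hUn ▸ ha)

end LinearAlgebra

section Topology

theorem frequently_notMem_of_derivedSet_subset {α : Type*} [TopologicalSpace α] [T1Space α]
    [PerfectSpace α] {s : Set α} {a : α} (hs : derivedSet s ⊆ {a}) : ∃ᶠ x in 𝓝[≠] a, x ∉ s := by
  intro h
  simp only [not_not] at h
  obtain ⟨b, hb, hba⟩ :=
    ((eventually_eventually_nhdsWithin.2 h).and self_mem_nhdsWithin).exists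
  rw [isOpen_compl_singleton.nhdsWithin_eq hba] at hb
  have hacc : AccPt b (𝓟 s) :=
    accPt_iff_frequently_nhdsNE.2 (hb.filter_mono nhdsWithin_le_nhds).frequently
  exact hba (hs hacc)

end Topology

section Banach

variable {𝕜 E F : Type*} [NontriviallyNormedField 𝕜] [NormedAddCommGroup E] [NormedSpace 𝕜 E]
  [CompleteSpace E] [NormedAddCommGroup F] [NormedSpace 𝕜 F] [CompleteSpace F]

theorem isClosed_map_of_ker_le {f : E →L[𝕜] F} (hf : IsClosed (Set.range f)) {P : Submodule 𝕜 E}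
    (hP : IsClosed (P : Set E)) (hker : f.ker ≤ P) : IsClosed (P.map f.toLinearMap : Set F) := by
  have hrange : IsClosed (f.range : Set F) := hf
  have := hrange.completeSpace_coe
  have hquot := f.rangeRestrict.isQuotientMap f.toLinearMap.surjective_rangeRestrict
  have himage : IsClosed (f.rangeRestrict '' P) := by
    have hpre : f.rangeRestrict ⁻¹' (f.rangeRestrict '' P) = P := by
      refine (Set.subset_preimage_image _ _).antisymm' ?_
      rintro x ⟨p, hp, hpx⟩
      have hxp : x - p ∈ f.ker := by
        rw [LinearMap.mem_ker, map_sub, sub_eq_zero]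
        exact congrArg Subtype.val hpx.symm
      exact (P.sub_mem_iff_left hp).1 (hker hxp)
    rwa [← hquot.isClosed_preimage, hpre]
  have := hrange.isClosedEmbedding_subtypeVal.isClosedMap _ himage
  rwa [← Set.image_comp] at this

theorem eventually_surjective {f : E →L[𝕜] F} (hf : Surjective f) :
    ∀ᶠ g : E →L[𝕜] F in 𝓝 f, Surjective g := by
  obtain ⟨r, hr₀⟩ := f.exists_nonlinearRightInverse_of_surjective (range_eq_top.2 hf)
  have hpos : (0 : ℝ) < (r.nnnorm : ℝ)⁻¹ := inv_pos.2 (NNReal.coe_pos.2 hr₀)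
  filter_upwards [Metric.ball_mem_nhds f hpos] with g hg y
  have happrox : ApproximatesLinearOn g f Set.univ ‖g - f‖₊ := fun x _ y _ => by
    simpa [sub_sub_sub_comm] using (g - f).le_opNorm (x - y)
  have hgap : 0 < (r.nnnorm : ℝ)⁻¹ - ‖g - f‖₊ := sub_pos.2 (mem_ball_iff_norm.1 hg)
  obtain ⟨x, -, hx⟩ := happrox.surjOn_closedBall_of_nonlinearRightInverse r (b := 0)
    (ε := ‖y‖ / ((r.nnnorm : ℝ)⁻¹ - ‖g - f‖₊)) (by positivity) (Set.subset_univ _)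
    (Metric.mem_closedBall.2 (by
      rw [mul_div_assoc', mul_div_cancel_left₀ _ hgap.ne', map_zero, dist_zero_right]))
  exact ⟨x, hx⟩

theorem eventually_injective {f : E →L[𝕜] F} (hf : Injective f) (hcl : IsClosed (Set.range f)) :
    ∀ᶠ g : E →L[𝕜] F in 𝓝 f, Injective g := by
  obtain ⟨K, hK⟩ := f.antilipschitz_of_injective_of_isClosed_range hf hcl
  have hK' : AntilipschitzWith (K + 1) f := fun x y => (hK x y).trans (by gcongr; simp)
  have hpos : 0 < ((K + 1 : NNReal) : ℝ)⁻¹ := by positivity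
  filter_upwards [Metric.ball_mem_nhds f hpos] with g hg
  have hlt : ‖g - f‖₊ < (K + 1)⁻¹ := by exact_mod_cast mem_ball_iff_norm.1 hg
  exact (hK'.add_sub_lipschitzWith (g - f).lipschitz hlt).injective

end Banach

section RankSemicontinuity

variable {𝕜 E F : Type*} [RCLike 𝕜] [NormedAddCommGroup E] [NormedSpace 𝕜 E] [CompleteSpace E]
  [NormedAddCommGroup F] [NormedSpace 𝕜 F] [CompleteSpace F] {f : E →L[𝕜] F}

theorem continuousAt_toENat_rank_ker (hf : Surjective f) :
    ContinuousAt (fun g : E →L[𝕜] F => (Module.rank 𝕜 g.ker).toENat) f := by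
  have hcont (U : Submodule 𝕜 E) (π : E →L[𝕜] U) :
      Continuous fun g : E →L[𝕜] F => g.prod π :=
    (ContinuousLinearMap.prodₗᵢ 𝕜).continuous.comp (continuous_id.prodMk continuous_const)
  have hsurj (U : Submodule 𝕜 E) (hU : U ≤ f.ker) (π : E →L[𝕜] U) (hπ : ∀ u : U, π u = u) :
      Surjective (f.prod π) := by
    have hsup : f.ker ⊔ π.ker = ⊤ := (isCompl_of_proj hπ).codisjoint.mono_left hU |>.eq_top
    refine range_eq_top.1 ((range_prod_eq hsup).trans ?_)
    rw [range_eq_top.2 hf, range_eq_of_proj hπ, Submodule.prod_top]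
  refine tendsto_toENat_rank (fun U hU hfin => ?_) fun hfin => ?_
  · obtain ⟨π, hπ⟩ := Submodule.ClosedComplemented.of_finiteDimensional U
    have := FiniteDimensional.complete 𝕜 U
    filter_upwards [(hcont U π).continuousAt.eventually
      (eventually_surjective (hsurj U hU π hπ))] with g hg
    exact rank_le_rank_ker_of_surjective_prod hg
  · obtain ⟨π, hπ⟩ := Submodule.ClosedComplemented.of_finiteDimensional f.ker
    have := FiniteDimensional.complete 𝕜 f.ker
    have hinj : Injective (f.prod π) :=
      ker_eq_bot.1 ((ker_prod _ _).trans (isCompl_of_proj hπ).inf_eq_bot)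
    have hclosed : IsClosed (Set.range (f.prod π)) :=
      (hsurj _ le_rfl π hπ).range_eq ▸ isClosed_univ
    filter_upwards [(hcont _ π).continuousAt.eventually
      (eventually_injective hinj hclosed)] with g hg
    exact rank_ker_le_of_injective_prod hg

theorem continuousAt_toENat_rank_quotient_range (hf : Injective f)
    (hclosed : IsClosed (Set.range f)) :
    ContinuousAt (fun g : E →L[𝕜] F => (Module.rank 𝕜 (F ⧸ g.range)).toENat) f := by
  obtain ⟨C, hC⟩ := Submodule.exists_isCompl f.range
  have hcont (U : Submodule 𝕜 F) : Continuous fun g : E →L[𝕜] F => g.coprod U.subtypeL := by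
    fun_prop
  have hrange (U : Submodule 𝕜 F) : (f.coprod U.subtypeL).range = f.range ⊔ U :=
    (range_coprod _ _).trans (by rw [U.toLinearMap_subtypeL, U.range_subtype])
  suffices Tendsto (fun g : E →L[𝕜] F => (Module.rank 𝕜 (F ⧸ g.range)).toENat) (𝓝 f)
      (𝓝 (Module.rank 𝕜 C).toENat) by
    rwa [← (Submodule.quotientEquivOfIsCompl _ C hC).rank_eq] at this
  refine tendsto_toENat_rank (fun U hU hfin => ?_) fun hfin => ?_
  · have := FiniteDimensional.complete 𝕜 U
    have hdisj : Disjoint f.range U.subtype.range := by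
      simpa using hC.disjoint.mono_right hU
    have hinj : Injective (f.coprod U.subtypeL) := ker_eq_bot.1 <|
      (ker_coprod_of_disjoint_range _ _ hdisj).trans <| by
        rw [ker_eq_bot.2 hf, U.ker_subtype, Submodule.prod_bot]
    have hclosedU : IsClosed ((f.coprod U.subtypeL).range : Set F) := by
      rw [hrange]
      exact Submodule.isClosed_sup_finiteDimensional _ _ hclosed
    filter_upwards [(hcont U).continuousAt.eventually
      (eventually_injective hinj hclosedU)] with g hg
    exact rank_le_rank_quotient_range_of_injective_coprod hg
  · have := FiniteDimensional.complete 𝕜 C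
    have hsurj : Surjective (f.coprod C.subtypeL) :=
      range_eq_top.1 ((hrange C).trans hC.sup_eq_top)
    filter_upwards [(hcont C).continuousAt.eventually (eventually_surjective hsurj)] with g hg
    exact rank_quotient_range_le_of_surjective_coprod hg

end RankSemicontinuity

section SemiRegular

theorem natInf_eq_zero_iff {S : Set ℕ} : natInf S = 0 ↔ 0 ∈ S := by
  simp [natInf, ENat.iInf_eq_zero]

theorem natInf_eq_ite {S : Set ℕ} {p : Prop} [Decidable p] (hp : p → 0 ∈ S)
    (hS : ∀ n ∈ S, p) : natInf S = if p then 0 else ⊤ := by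
  split_ifs with h
  · exact natInf_eq_zero_iff.2 (hp h)
  · exact iInf₂_eq_top.2 fun n hn => absurd (hS n hn) h

variable {Y : Type*} [NormedAddCommGroup Y] [NormedSpace ℂ Y] {A : Y →L[ℂ] Y}

theorem kerPow_eq_ker_pow (n : ℕ) : kerPow A n = ker (A.toLinearMap ^ n) := by
  rw [kerPow, ContinuousLinearMap.toLinearMap_pow]

theorem rangePow_eq_range_pow (n : ℕ) : rangePow A n = range (A.toLinearMap ^ n) := by
  rw [rangePow, ContinuousLinearMap.toLinearMap_pow]

theorem alpha_eq_zero_iff : alpha A = 0 ↔ A.ker = ⊥ := by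
  rw [alpha, Cardinal.toENat_eq_zero, rank_zero_iff, Submodule.subsingleton_iff_eq_bot]

theorem beta_eq_zero_iff : beta A = 0 ↔ A.range = ⊤ := by
  rw [beta, Cardinal.toENat_eq_zero, rank_zero_iff, Submodule.Quotient.subsingleton_iff]

theorem IsSemiRegular.ker_le_hyperrange (hA : IsSemiRegular A) :
    A.ker ≤ hyperrange A.toLinearMap := by
  refine le_iInf fun n => ?_
  have h : kerPow A 1 ⊓ rangePow A 0 = kerPow A 1 ⊓ rangePow A n :=
    natInf_eq_zero_iff.1 hA.2 n n.zero_le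
  simp only [kerPow_eq_ker_pow, rangePow_eq_range_pow, pow_one, pow_zero, End.one_eq_id,
    range_id, inf_top_eq] at h
  exact inf_eq_left.1 h.symm

theorem IsSemiRegular.ascent_eq_ite (hA : IsSemiRegular A) :
    ascent A = if alpha A = 0 then 0 else ⊤ := by
  refine natInf_eq_ite (fun h => ?_) fun n hn => alpha_eq_zero_iff.2 ?_
  · simpa [kerPow_eq_ker_pow, End.one_eq_id, eq_comm] using alpha_eq_zero_iff.1 h
  · rw [Set.mem_ofPred_eq, kerPow_eq_ker_pow, kerPow_eq_ker_pow] at hn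
    exact ker_eq_bot_of_ker_pow_eq hA.ker_le_hyperrange hn

theorem IsSemiRegular.descent_eq_ite (hA : IsSemiRegular A) :
    descent A = if beta A = 0 then 0 else ⊤ := by
  refine natInf_eq_ite (fun h => ?_) fun n hn => beta_eq_zero_iff.2 ?_
  · simpa [rangePow_eq_range_pow, End.one_eq_id, eq_comm] using beta_eq_zero_iff.1 h
  · rw [Set.mem_ofPred_eq, rangePow_eq_range_pow, rangePow_eq_range_pow] at hn
    exact range_eq_top_of_range_pow_eq hA.ker_le_hyperrange hn

theorem IsSemiRegular.surjective_restrict_hyperrange (hA : IsSemiRegular A) :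
    Surjective (A.restrict (map_mem_hyperrange (f := A.toLinearMap))) := by
  rintro ⟨y, hy⟩
  rw [← map_hyperrange hA.ker_le_hyperrange] at hy
  obtain ⟨x, hx, rfl⟩ := hy
  exact ⟨⟨x, hx⟩, rfl⟩

theorem tendsto_sub_smul_one (A : Y →L[ℂ] Y) :
    Tendsto (fun z : ℂ => A - z • 1) (𝓝 0) (𝓝 A) := by
  have h : Continuous fun z : ℂ => A - z • 1 := by fun_prop
  simpa using h.tendsto 0

theorem sub_smul_one_mem {P : Submodule ℂ Y} (hP : ∀ x ∈ P, A x ∈ P) (z : ℂ) :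
    ∀ x ∈ P, (A - z • 1) x ∈ P :=
  fun x hx => P.sub_mem (hP x hx) (P.smul_mem z hx)

variable [CompleteSpace Y]

theorem IsSemiRegular.isClosed_range_pow (hA : IsSemiRegular A) (n : ℕ) :
    IsClosed (range (A.toLinearMap ^ n) : Set Y) := by
  induction n with
  | zero => simp [End.one_eq_id]
  | succ n ih =>
    rw [pow_succ', End.mul_eq_comp, range_comp]
    exact isClosed_map_of_ker_le hA.1 ih
      (hA.ker_le_hyperrange.trans (hyperrange_le_range_pow n))

theorem IsSemiRegular.isClosed_hyperrange (hA : IsSemiRegular A) :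
    IsClosed (hyperrange A.toLinearMap : Set Y) := by
  rw [hyperrange, Submodule.coe_iInf]
  exact isClosed_iInter hA.isClosed_range_pow

theorem IsSemiRegular.tendsto_alpha_sub_smul_one (hA : IsSemiRegular A) :
    Tendsto (fun z : ℂ => alpha (A - z • 1)) (𝓝[≠] 0) (𝓝 (alpha A)) := by
  have := hA.isClosed_hyperrange.completeSpace_coe
  set B := A.restrict (map_mem_hyperrange (f := A.toLinearMap))
  have hB₀ : alpha B = alpha A :=
    congrArg Cardinal.toENat (rank_ker_restrict map_mem_hyperrange hA.ker_le_hyperrange)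
  have hB (z : ℂ) (hz : z ≠ 0) : alpha (B - z • 1) = alpha (A - z • 1) :=
    congrArg Cardinal.toENat (rank_ker_restrict (sub_smul_one_mem map_mem_hyperrange z)
      (End.eigenspace_def.symm.trans_le (eigenspace_le_hyperrange hz)))
  have hlim : Tendsto (fun z : ℂ => alpha (B - z • 1)) (𝓝 0) (𝓝 (alpha B)) :=
    (continuousAt_toENat_rank_ker hA.surjective_restrict_hyperrange).tendsto.comp
      (tendsto_sub_smul_one B)
  rw [← hB₀]
  refine (hlim.mono_left nhdsWithin_le_nhds).congr' ?_
  filter_upwards [self_mem_nhdsWithin] with z hz using hB z hz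

end SemiRegular

section Quotient

variable {Y : Type*} [NormedAddCommGroup Y] [NormedSpace ℂ Y] {A : Y →L[ℂ] Y}
  {R : Submodule ℂ Y}

/-- The operator induced on `Y ⧸ R` by a bounded operator leaving `R` invariant. -/
def quotientOperator (A : Y →L[ℂ] Y) (R : Submodule ℂ Y) (hR : R ≤ R.comap A.toLinearMap) :
    Y ⧸ R →L[ℂ] Y ⧸ R :=
  R.liftQL (R.mkQL ∘L A) fun _ hx => (Submodule.Quotient.mk_eq_zero R).2 (hR hx)

theorem quotientOperator_sub_smul_one (hR : R ≤ R.comap A.toLinearMap) (z : ℂ) :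
    quotientOperator A R hR - z • 1 =
      quotientOperator (A - z • 1) R (sub_smul_one_mem hR z) := by
  apply ContinuousLinearMap.coe_injective
  apply Submodule.linearMap_qext
  rfl

theorem beta_quotientOperator [IsClosed (R : Set Y)] (hR : R ≤ R.comap A.toLinearMap)
    (hA : R ≤ A.range) : beta (quotientOperator A R hR) = beta A :=
  congrArg Cardinal.toENat (rank_quotient_range_mapQ hR hA)

theorem injective_quotientOperator (hR : R.comap A.toLinearMap = R) :
    Injective (quotientOperator A R hR.ge) :=
  ker_eq_bot.1 (Submodule.ker_liftQ_eq_bot _ _ _ (by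
    rw [ContinuousLinearMap.toLinearMap_comp, ker_comp, Submodule.toLinearMap_mkQL,
      Submodule.ker_mkQ, hR]))

theorem isClosed_range_quotientOperator [CompleteSpace Y] [IsClosed (R : Set Y)]
    (hR : R ≤ R.comap A.toLinearMap) (hA : R ≤ A.range) (hclosed : IsClosed (Set.range A)) :
    IsClosed (Set.range (quotientOperator A R hR)) := by
  have hmk : IsClosed (Set.range R.mkQL) := R.mkQ_surjective.range_eq ▸ isClosed_univ
  have := isClosed_map_of_ker_le hmk (P := A.range) hclosed (R.ker_mkQ.trans_le hA)
  rwa [Submodule.toLinearMap_mkQL, ← Submodule.range_mapQ (h := hR)] at this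

theorem IsSemiRegular.tendsto_beta_sub_smul_one [CompleteSpace Y] (hA : IsSemiRegular A) :
    Tendsto (fun z : ℂ => beta (A - z • 1)) (𝓝 0) (𝓝 (beta A)) := by
  have hcomap := comap_hyperrange hA.ker_le_hyperrange
  have hle : ∀ᶠ z : ℂ in 𝓝 0, hyperrange A.toLinearMap ≤ (A - z • 1).range := by
    have := hA.isClosed_hyperrange.completeSpace_coe
    filter_upwards [(tendsto_sub_smul_one _).eventually
      (eventually_surjective hA.surjective_restrict_hyperrange)] with z hz y hy
    obtain ⟨x, hx⟩ := hz ⟨y, hy⟩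
    exact ⟨x, congrArg Subtype.val hx⟩
  have := hA.isClosed_hyperrange
  rw [← beta_quotientOperator hcomap.ge hyperrange_le_range]
  have hlim := (continuousAt_toENat_rank_quotient_range (injective_quotientOperator hcomap)
    (isClosed_range_quotientOperator hcomap.ge hyperrange_le_range hA.1)).tendsto.comp
      (tendsto_sub_smul_one _)
  refine hlim.congr' ?_
  filter_upwards [hle] with z hz
  exact (congrArg beta (quotientOperator_sub_smul_one _ z)).trans (beta_quotientOperator _ hz)

end Quotient

section Decomposition

variable {X : Type*} [NormedAddCommGroup X] [NormedSpace ℂ X] {T : X →L[ℂ] X}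

section Reduction

variable {M N : Submodule ℂ X} {z : ℂ}

theorem IsRed.bijective_restrict_sub_smul_one (h : IsRed T M N)
    (hz : z ∉ spectrum ℂ (restr T N h.inv_right)) :
    Bijective ((T - z • 1).restrict (sub_smul_one_mem h.inv_right z)) := by
  obtain ⟨u, hu⟩ : IsUnit (restr T N h.inv_right - z • 1) := by
    simpa [Algebra.algebraMap_eq_smul_one] using (spectrum.notMem_iff.1 hz).neg
  have hbij : Bijective (restr T N h.inv_right - z • 1 : N →L[ℂ] N) := by
    rw [← hu]
    exact (ContinuousLinearEquiv.unitsEquiv ℂ N u).bijective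
  exact hbij

theorem IsRed.alpha_restr_sub_smul_one (h : IsRed T M N)
    (hz : z ∉ spectrum ℂ (restr T N h.inv_right)) :
    alpha (restr T M h.inv_left - z • 1) = alpha (T - z • 1) :=
  congrArg Cardinal.toENat (rank_ker_restrict (sub_smul_one_mem h.inv_left z)
    (ker_le_of_isCompl_of_injective_restrict (sub_smul_one_mem h.inv_left z)
      (sub_smul_one_mem h.inv_right z) h.isCompl (h.bijective_restrict_sub_smul_one hz).1))

theorem IsRed.beta_restr_sub_smul_one (h : IsRed T M N)
    (hz : z ∉ spectrum ℂ (restr T N h.inv_right)) :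
    beta (restr T M h.inv_left - z • 1) = beta (T - z • 1) :=
  congrArg Cardinal.toENat (rank_quotient_range_restrict_of_isCompl
    (sub_smul_one_mem h.inv_left z) (sub_smul_one_mem h.inv_right z) h.isCompl
    (h.bijective_restrict_sub_smul_one hz).2)

end Reduction

variable {M₁ N₁ M₂ N₂ : Submodule ℂ X}

theorem IsGzKD.frequently_notMem_spectrum (h₁ : IsGzKD T M₁ N₁) (h₂ : IsGzKD T M₂ N₂) :
    ∃ᶠ z in 𝓝[≠] 0, z ∉ spectrum ℂ (restr T N₁ h₁.inv_right) ∧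
      z ∉ spectrum ℂ (restr T N₂ h₂.inv_right) := by
  have := frequently_notMem_of_derivedSet_subset
    ((derivedSet_union _ _).trans_subset (Set.union_subset h₁.zeroloid h₂.zeroloid))
  simpa only [Set.mem_union, not_or] using this

variable [CompleteSpace X]

theorem IsGzKD.alpha_eq (h₁ : IsGzKD T M₁ N₁) (h₂ : IsGzKD T M₂ N₂) :
    alpha (restr T M₁ h₁.inv_left) = alpha (restr T M₂ h₂.inv_left) := by
  have := h₁.closed_left.completeSpace_coe
  have := h₂.closed_left.completeSpace_coe
  refine tendsto_nhds_unique_of_frequently_eq h₁.semiRegular.tendsto_alpha_sub_smul_one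
    h₂.semiRegular.tendsto_alpha_sub_smul_one ?_
  exact (h₁.frequently_notMem_spectrum h₂).mono fun z hz =>
    (h₁.alpha_restr_sub_smul_one hz.1).trans (h₂.alpha_restr_sub_smul_one hz.2).symm

theorem IsGzKD.beta_eq (h₁ : IsGzKD T M₁ N₁) (h₂ : IsGzKD T M₂ N₂) :
    beta (restr T M₁ h₁.inv_left) = beta (restr T M₂ h₂.inv_left) := by
  have := h₁.closed_left.completeSpace_coe
  have := h₂.closed_left.completeSpace_coe
  refine tendsto_nhds_unique_of_frequently_eq (l := 𝓝[≠] (0 : ℂ))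
    (h₁.semiRegular.tendsto_beta_sub_smul_one.mono_left nhdsWithin_le_nhds)
    (h₂.semiRegular.tendsto_beta_sub_smul_one.mono_left nhdsWithin_le_nhds) ?_
  exact (h₁.frequently_notMem_spectrum h₂).mono fun z hz =>
    (h₁.beta_restr_sub_smul_one hz.1).trans (h₂.beta_restr_sub_smul_one hz.2).symm

theorem IsGzKD.invariants_eq (h₁ : IsGzKD T M₁ N₁) (h₂ : IsGzKD T M₂ N₂) :
    alpha (restr T M₁ h₁.inv_left) = alpha (restr T M₂ h₂.inv_left) ∧
      beta (restr T M₁ h₁.inv_left) = beta (restr T M₂ h₂.inv_left) ∧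
      ascent (restr T M₁ h₁.inv_left) = ascent (restr T M₂ h₂.inv_left) ∧
      descent (restr T M₁ h₁.inv_left) = descent (restr T M₂ h₂.inv_left) := by
  refine ⟨h₁.alpha_eq h₂, h₁.beta_eq h₂, ?_, ?_⟩
  · rw [h₁.semiRegular.ascent_eq_ite, h₂.semiRegular.ascent_eq_ite, h₁.alpha_eq h₂]
  · rw [h₁.semiRegular.descent_eq_ite, h₂.semiRegular.descent_eq_ite, h₁.beta_eq h₂]

end Decomposition

end GzKato

theorem proposition2p8 {X : Type*} [NormedAddCommGroup X] [NormedSpace ℂ X] [CompleteSpace X]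
    (T : X →L[ℂ] X) (hT : GzKato.IsGzKato T) :
    (∀ (M₁ N₁ M₂ N₂ : Submodule ℂ X)
        (h₁ : GzKato.IsGzKD T M₁ N₁) (h₂ : GzKato.IsGzKD T M₂ N₂),
      GzKato.alpha (GzKato.restr T M₁ h₁.inv_left) =
          GzKato.alpha (GzKato.restr T M₂ h₂.inv_left) ∧
      GzKato.beta (GzKato.restr T M₁ h₁.inv_left) =
          GzKato.beta (GzKato.restr T M₂ h₂.inv_left) ∧
      GzKato.ascent (GzKato.restr T M₁ h₁.inv_left) =
          GzKato.ascent (GzKato.restr T M₂ h₂.inv_left) ∧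
      GzKato.descent (GzKato.restr T M₁ h₁.inv_left) =
          GzKato.descent (GzKato.restr T M₂ h₂.inv_left)) ∧
    (∀ (M N : Submodule ℂ X) (h : GzKato.IsGzKD T M N),
      GzKato.alphaTilde T hT = GzKato.alpha (GzKato.restr T M h.inv_left) ∧
      GzKato.betaTilde T hT = GzKato.beta (GzKato.restr T M h.inv_left) ∧
      GzKato.ascentTilde T hT = GzKato.ascent (GzKato.restr T M h.inv_left) ∧
      GzKato.descentTilde T hT = GzKato.descent (GzKato.restr T M h.inv_left)) := by
  exact ⟨fun _ _ _ _ h₁ h₂ => h₁.invariants_eq h₂,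
    fun _ _ h => hT.choose_spec.choose_spec.invariants_eq h⟩
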